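/- **Theorem (Nonlinear Setting).** For every $L>0$ and $M\ge 0$ there is a constant $C>0$, depending only on $L$ and $M$, such that the following holds. Let $(X_t)_{t\ge 0}$ be a time-homogeneous Markov chain with an arbitrary initial law on a finite state space $\mathcal S$ (the space of data tuples), with irreducible and aperiodic transition matrix $P$ and stationary distribution $\pi$. Let $g:\mathcal S\times\mathbb R^K\to\mathbb R^K$ satisfy $\|g(x,\theta_1)-g(x,\theta_2)\|_2\le L\|\theta_1-\theta_2\|_2$ and $\|g(x,0)\|_2\le M$ for all $x\in\mathcal S$ and $\theta_1,\theta_2\in\mathbb R^K$. Put $\bar g(\theta)=\mathbb E_{X\sim\pi}[g(X,\theta)]$, and suppose that $\bar g(\theta^*)=0$ and that, for some $\beta>0$, $$\langle\theta-\theta^*,\bar g(\theta)-\bar g(\theta^*)\rangle\le-\beta\|\theta-\theta^*\|_2^2\qquad\text{for all }\theta\in\mathbb R^K.$$ Let $\delta\ge1$ and let $\mathcal Q_\delta:\mathbb R^K\to\mathbb R^K$ satisfy $\|\mathcal Q_\delta(\theta)-\theta\|_2^2\le(1-1/\delta)\|\theta\|_2^2$ for all $\theta$. Let $\mathcal B\subset\mathbb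 R^K$ be a compact convex set with $\theta^*\in\mathcal B$ and $\|\theta\|_2\le G$ for all $\theta\in\mathcal B$, where $G\ge1$, and let $\Pi_{\mathcal B}$ be the Euclidean projection onto $\mathcal B$. Let $\alpha\in(0,1)$ with $\alpha\beta<1$, let $\theta_0\in\mathcal B$, $e_{-1}=0$, and for $t\ge0$ $$h_t=\mathcal Q_\delta\big(e_{t-1}+g(X_t,\theta_t)\big),\qquad \theta_{t+1}=\Pi_{\mathcal B}(\theta_t+\alpha h_t),\qquad e_t=e_{t-1}+g(X_t,\theta_t)-h_t .$$ Then the mixing time $$\tau=\min\big\{t\ge1:\ \|\mathbb E[g(X_k,\theta)\mid X_0=s]-\bar g(\theta)\|_2\le\alpha(\|\theta\|_2+1)\ \ \forall k\ge t,\ \forall\theta\in\mathbb R^K,\ \forall s\in\mathcal S\big\}$$ (the conditional expectation being the one given by $P^k$) is finite, and for all $T\ge\tau$ $$\mathbb E\big[\|\theta_T-\theta^*\|_2^2\big]\le C_1(1-\alpha\beta)^{T-\tau}+C\,\frac{\alpha\tau\delta^2G^2}{\beta},\qquad C_1=C\,(\alpha^2\delta^2G^2+G^2).$$ -/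

import Mathlib

open MeasureTheory

noncomputable section

namespace EFSA

/-- `X` is a time-homogeneous Markov chain with transition matrix `P` under `μ` (and an arbitrary
initial law): each next state is drawn from the row of `P` at the current state, whatever the
earlier path was. -/
structure IsMarkovChain {S Ω : Type*} [MeasurableSpace S] [MeasurableSpace Ω]
    (P : Matrix S S ℝ) (μ : Measure Ω) (X : ℕ → Ω → S) : Prop where
  measurable : ∀ t, Measurable (X t)
  step : ∀ (n : ℕ) (x : ℕ → S),
    μ.real {ω | ∀ i ≤ n + 1, X i ω = x i} =
      μ.real {ω | ∀ i ≤ n, X i ω = x i} * P (x n) (x (n + 1))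

section Chain

variable {S : Type*} [Fintype S] [DecidableEq S]

/-- Every state has period one: its possible return times have greatest common divisor `1`. -/
def IsAperiodic (P : Matrix S S ℝ) : Prop :=
  ∀ s, Nat.setGcd {n : ℕ | 1 ≤ n ∧ 0 < (P ^ n) s s} = 1

/-- `p` is a stationary probability vector of `P`. -/
def IsStationary (P : Matrix S S ℝ) (p : S → ℝ) : Prop :=
  p ∈ stdSimplex ℝ S ∧ Matrix.vecMul p P = p

variable {K : ℕ}

/-- The averaged map `θ ↦ 𝔼_{X ∼ p} [g(X, θ)]`. -/
def meanField (p : S → ℝ) (g : S → EuclideanSpace ℝ (Fin K) → EuclideanSpace ℝ (Fin K))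
    (θ : EuclideanSpace ℝ (Fin K)) : EuclideanSpace ℝ (Fin K) :=
  ∑ s, p s • g s θ

/-- The conditional mean `𝔼[g(X_k, θ) | X_0 = s]` of a chain with transition matrix `P`. -/
def condMean (P : Matrix S S ℝ)
    (g : S → EuclideanSpace ℝ (Fin K) → EuclideanSpace ℝ (Fin K))
    (k : ℕ) (s : S) (θ : EuclideanSpace ℝ (Fin K)) : EuclideanSpace ℝ (Fin K) :=
  ∑ x, (P ^ k) s x • g x θ

/-- The lags `t ≥ 1` from which on the conditional mean is within `ε (‖θ‖ + 1)` of the averaged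
map. The mixing time at precision `ε` is the least element of this set. -/
def mixingLags (P : Matrix S S ℝ) (p : S → ℝ)
    (g : S → EuclideanSpace ℝ (Fin K) → EuclideanSpace ℝ (Fin K)) (ε : ℝ) : Set ℕ :=
  {t | 1 ≤ t ∧ ∀ k ≥ t, ∀ (θ : EuclideanSpace ℝ (Fin K)) (s : S),
    ‖condMean P g k s θ - meanField p g θ‖ ≤ ε * (‖θ‖ + 1)}

end Chain

section Algorithm

variable {S : Type*} {K : ℕ}

/-- `Q` is a compression operator with compression parameter `δ`. -/
def IsCompressor (δ : ℝ) (Q : EuclideanSpace ℝ (Fin K) → EuclideanSpace ℝ (Fin K)) : Prop :=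
  ∀ θ, ‖Q θ - θ‖ ^ 2 ≤ (1 - 1 / δ) * ‖θ‖ ^ 2

/-- Euclidean projection onto `B`: the point of `B` that is nearest to `x` (it exists and is unique
when `B` is nonempty, compact and convex). -/
def proj (B : Set (EuclideanSpace ℝ (Fin K))) (x : EuclideanSpace ℝ (Fin K)) :
    EuclideanSpace ℝ (Fin K) :=
  Classical.epsilon fun y => y ∈ B ∧ ∀ z ∈ B, dist x y ≤ dist x z

/-- The pair `(θ_t, e_{t-1})` (parameter, memory) of the projected error-feedback scheme driven by
the observations `x 0, x 1, …`: starting from `(θ₀, 0)`,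
`h_t = Q (e_{t-1} + g(x_t, θ_t))`, `θ_{t+1} = proj B (θ_t + α h_t)`,
`e_t = e_{t-1} + g(x_t, θ_t) - h_t`. -/
def efState (g : S → EuclideanSpace ℝ (Fin K) → EuclideanSpace ℝ (Fin K))
    (Q : EuclideanSpace ℝ (Fin K) → EuclideanSpace ℝ (Fin K))
    (B : Set (EuclideanSpace ℝ (Fin K))) (α : ℝ) (θ₀ : EuclideanSpace ℝ (Fin K)) (x : ℕ → S) :
    ℕ → EuclideanSpace ℝ (Fin K) × EuclideanSpace ℝ (Fin K)
  | 0 => (θ₀, 0)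
  | t + 1 =>
    let θ := (efState g Q B α θ₀ x t).1
    let e := (efState g Q B α θ₀ x t).2
    let h := Q (e + g (x t) θ)
    (proj B (θ + α • h), e + g (x t) θ - h)

/-- The iterate `θ_t` of the projected error-feedback scheme. -/
def efIterate (g : S → EuclideanSpace ℝ (Fin K) → EuclideanSpace ℝ (Fin K))
    (Q : EuclideanSpace ℝ (Fin K) → EuclideanSpace ℝ (Fin K))
    (B : Set (EuclideanSpace ℝ (Fin K))) (α : ℝ) (θ₀ : EuclideanSpace ℝ (Fin K)) (x : ℕ → S)
    (t : ℕ) : EuclideanSpace ℝ (Fin K) :=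
  (efState g Q B α θ₀ x t).1

end Algorithm

end EFSA

end

noncomputable section

namespace EFSA

/-! ### Ergodicity: geometric convergence of the chain, hence a finite mixing time. -/

section Mixing

variable {S : Type*} [Fintype S] [DecidableEq S]

/-! Compression errors are remembered, not lost, so the virtual iterate `θ_t + α e_{t-1}` moves by
exactly `α g(X_t, θ_t)` plus the projection residual. On `B` the map `g` is bounded by `σ = (L +
|M|) G`, and the contraction of the compressor keeps the memory below `2 δ σ`
(`norm_efState_snd_le`). So the virtual and true iterates differ by `O(α δ σ)`. By the variational
inequality for the projection, the residual contributes only `O(α² δ² σ²)` to the squared error.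
With strong monotonicity this gives contraction by `1 - α β`, up to the Markov bias `2 α ⟨θ_t - θ*,
g(X_t, θ_t) - ḡ(θ_t)⟩` (`norm_virtual_step_sq_le`).

Since `θ_t` and `X_t` are correlated, the bias does not average out directly. It is Lipschitz in the
parameter (`bias_sub_le`), so `θ_t` may be replaced by `θ_{t-τ}` at the price of the drift over `τ`
steps, `O(τ α δ σ)`. Given the past up to `t - τ`, the law of `X_t` is a row of `P ^ τ`, and the
definition of `τ` makes the remaining mean `O(α G²)` (`integral_bias_le`). Solving the recursion
from time `τ` on (`le_geometric_of_succ_le`) divides the `O(α² τ δ² G²)` perturbation by `α β`.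

The mixing time is finite because an irreducible aperiodic matrix has a positive power, to which
Doeblin's contraction applies (`exists_forall_sum_abs_pow_sub_le`). -/

lemma pow_add_apply_pos {P : Matrix S S ℝ} (hP : ∀ i j, 0 ≤ P i j) {m n : ℕ} {i j k : S}
    (hij : 0 < (P ^ m) i j) (hjk : 0 < (P ^ n) j k) : 0 < (P ^ (m + n)) i k := by
  rw [pow_add, Matrix.mul_apply]
  exact Finset.sum_pos' (fun x _ => mul_nonneg (Matrix.pow_apply_nonneg hP m i x)
    (Matrix.pow_apply_nonneg hP n x k)) ⟨j, Finset.mem_univ j, mul_pos hij hjk⟩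

/-- In an aperiodic chain every state has all large enough numbers as return times. -/
lemma IsAperiodic.eventually_pos {P : Matrix S S ℝ} (hP : ∀ i j, 0 ≤ P i j)
    (hap : IsAperiodic P) (s : S) : ∃ n, ∀ m ≥ n, 0 < (P ^ m) s s := by
  -- Every large multiple of the gcd of a set of naturals is a sum of its elements, and return times
  -- are closed under addition.
  obtain ⟨n, hn⟩ := Nat.exists_mem_closure_of_ge {n : ℕ | 1 ≤ n ∧ 0 < (P ^ n) s s}
  refine ⟨n, fun m hm => ?_⟩
  have hmem := hn m hm (by rw [hap s]; exact one_dvd m)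
  clear hm
  induction hmem using AddSubmonoid.closure_induction with
  | mem x hx => exact hx.2
  | zero => simp
  | add x y _ _ hx hy => exact pow_add_apply_pos hP hx hy

/-- An irreducible aperiodic nonnegative matrix has an entrywise positive power. -/
lemma IsAperiodic.isPrimitive {P : Matrix S S ℝ} (hirr : P.IsIrreducible)
    (hap : IsAperiodic P) : P.IsPrimitive := by
  have hP := hirr.nonneg
  choose k _ hk using (Matrix.isIrreducible_iff_exists_pow_pos hP).1 hirr
  choose n hn using hap.eventually_pos hP
  -- The exponent exceeds every `k i j + n i`: loop at `i` for the surplus time, then travel to `j`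
  -- in `k i j` steps.
  refine ⟨hP, ∑ i, ∑ j, k i j + ∑ i, n i + 1, Nat.succ_pos _, fun i j => ?_⟩
  have h1 : k i j ≤ ∑ i, ∑ j, k i j :=
    (Finset.single_le_sum (f := fun j => k i j) (fun _ _ => Nat.zero_le _)
      (Finset.mem_univ j)).trans
      (Finset.single_le_sum (f := fun i => ∑ j, k i j) (fun _ _ => Nat.zero_le _)
        (Finset.mem_univ i))
  have h2 : n i ≤ ∑ i, n i :=
    Finset.single_le_sum (f := n) (fun _ _ => Nat.zero_le _) (Finset.mem_univ i)
  have h3 : ∑ i, ∑ j, k i j + ∑ i, n i + 1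
      = (∑ i, ∑ j, k i j + ∑ i, n i + 1 - k i j) + k i j := by omega
  rw [h3]
  exact pow_add_apply_pos hP (hn i _ (by omega)) (hk i j)

/-- Doeblin's contraction: on row vectors of total mass zero, a stochastic matrix with entries at
least `c` contracts the `ℓ¹` norm by the factor `1 - c · |S|`. -/
lemma sum_abs_vecMul_le {R : Matrix S S ℝ} (hR : R ∈ Matrix.rowStochastic ℝ S) {c : ℝ}
    (hc : ∀ i j, c ≤ R i j) {v : S → ℝ} (hv : ∑ i, v i = 0) :
    ∑ j, |Matrix.vecMul v R j| ≤ (1 - c * Fintype.card S) * ∑ i, |v i| := by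
  have h1 : ∀ j, |Matrix.vecMul v R j| ≤ ∑ i, |v i| * (R i j - c) := by
    intro j
    -- Subtracting `c` from every entry is invisible to a vector of mass zero.
    have h2 : Matrix.vecMul v R j = ∑ i, v i * (R i j - c) := by
      simp only [Matrix.vecMul, dotProduct, mul_sub, Finset.sum_sub_distrib, ← Finset.sum_mul, hv]
      ring
    rw [h2]
    refine (Finset.abs_sum_le_sum_abs _ _).trans_eq (Finset.sum_congr rfl fun i _ => ?_)
    rw [abs_mul, abs_of_nonneg (sub_nonneg.2 (hc i j))]
  refine (Finset.sum_le_sum fun j _ => h1 j).trans_eq ?_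
  rw [Finset.sum_comm, Finset.mul_sum]
  refine Finset.sum_congr rfl fun i _ => ?_
  rw [← Finset.mul_sum, Finset.sum_sub_distrib, Matrix.sum_row_of_mem_rowStochastic hR]
  simp
  ring

/-- The `ℓ¹` distance of `P ^ k` to the stationary law is small for all large `k`, uniformly in
the initial state. -/
lemma exists_forall_sum_abs_pow_sub_le {P : Matrix S S ℝ} {p : S → ℝ}
    (hP : P ∈ Matrix.rowStochastic ℝ S) (hirr : P.IsIrreducible) (hap : IsAperiodic P)
    (hp : IsStationary P p) {ε : ℝ} (hε : 0 < ε) :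
    ∃ N, ∀ k ≥ N, ∀ s, ∑ x, |(P ^ k) s x - p x| ≤ ε := by
  obtain ⟨-, m, -, hm⟩ := hap.isPrimitive hirr
  have hne : Nonempty S := by
    by_contra h
    rw [not_nonempty_iff] at h
    have := hp.1.2
    simp at this
  obtain ⟨c, hc0, hc⟩ : ∃ c > 0, ∀ i j, c ≤ (P ^ m) i j := by
    obtain ⟨q, hq⟩ := Finite.exists_min fun q : S × S => (P ^ m) q.1 q.2
    exact ⟨_, hm q.1 q.2, fun i j => hq (i, j)⟩
  have hPm : ∀ k, P ^ k ∈ Matrix.rowStochastic ℝ S := fun k => pow_mem hP k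
  set ρ : ℝ := 1 - c * Fintype.card S with hρ
  have hcard : (0 : ℝ) < Fintype.card S := by exact_mod_cast Fintype.card_pos
  have hρ1 : ρ < 1 := by
    have := mul_pos hc0 hcard
    linarith
  have hρ0 : 0 ≤ ρ := by
    obtain ⟨s⟩ := hne
    have h1 := Matrix.sum_row_of_mem_rowStochastic (hPm m) s
    have h2 : ∑ _j : S, c ≤ ∑ j, (P ^ m) s j := Finset.sum_le_sum fun j _ => hc s j
    simp at h2
    linarith [mul_comm c (Fintype.card S : ℝ)]
  have hrow : ∀ k s, Matrix.vecMul (Pi.single s 1 - p) (P ^ k) = fun x => (P ^ k) s x - p x := by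
    intro k s
    have hst : Matrix.vecMul p (P ^ k) = p := by
      induction k with
      | zero => simp
      | succ k ih => rw [pow_succ, ← Matrix.vecMul_vecMul, ih, hp.2]
    rw [Matrix.sub_vecMul, hst]
    ext x
    simp
  have hz : ∀ k s, ∑ x, ((P ^ k) s x - p x) = 0 := by
    intro k s
    rw [Finset.sum_sub_distrib, Matrix.sum_row_of_mem_rowStochastic (hPm k), hp.1.2, sub_self]
  have hstep : ∀ k l s, Matrix.vecMul (fun x => (P ^ k) s x - p x) (P ^ l)
      = fun x => (P ^ (k + l)) s x - p x := by
    intro k l s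
    rw [← hrow, ← hrow, Matrix.vecMul_vecMul, pow_add]
  have hpow : ∀ n s, ∑ x, |(P ^ (m * n)) s x - p x| ≤ ρ ^ n * 2 := by
    intro n s
    induction n with
    | zero =>
      have h1 : ∀ x, |(P ^ 0) s x - p x| ≤ (P ^ 0) s x + p x := fun x => by
        refine (abs_sub _ _).trans_eq ?_
        rw [abs_of_nonneg ((hPm 0).1 s x), abs_of_nonneg (hp.1.1 x)]
      simp only [mul_zero, pow_zero ρ, one_mul]
      refine (Finset.sum_le_sum fun x _ => h1 x).trans ?_
      rw [Finset.sum_add_distrib, Matrix.sum_row_of_mem_rowStochastic (hPm 0), hp.1.2]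
      norm_num
    | succ n ih =>
      have h := sum_abs_vecMul_le (hPm m) hc (hz (m * n) s)
      rw [hstep] at h
      rw [mul_add_one, pow_succ]
      refine h.trans ?_
      calc ρ * _ ≤ ρ * (ρ ^ n * 2) := mul_le_mul_of_nonneg_left ih hρ0
        _ = _ := by ring
  obtain ⟨n, hn⟩ := exists_pow_lt_of_lt_one (half_pos hε) hρ1
  refine ⟨m * n, fun k hk s => ?_⟩
  obtain ⟨l, rfl⟩ := exists_add_of_le hk
  -- With `c = 0` the contraction lemma says that further steps never increase the distance, so the
  -- bound at time `m * n` persists.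
  have h := sum_abs_vecMul_le (c := 0) (hPm l) (fun i j => (hPm l).1 i j) (hz (m * n) s)
  rw [hstep] at h
  refine h.trans ?_
  have := hpow n s
  linarith

lemma norm_apply_le_of_lipschitz {K : ℕ} {L M : ℝ}
    {f : EuclideanSpace ℝ (Fin K) → EuclideanSpace ℝ (Fin K)}
    (hL : ∀ θ₁ θ₂, ‖f θ₁ - f θ₂‖ ≤ L * ‖θ₁ - θ₂‖) (hM : ‖f 0‖ ≤ M)
    (θ : EuclideanSpace ℝ (Fin K)) : ‖f θ‖ ≤ L * ‖θ‖ + M := by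
  have h := hL θ 0
  rw [sub_zero] at h
  have := norm_sub_norm_le (f θ) (f 0)
  linarith

/-- The mixing time is finite. -/
lemma mixingLags_nonempty {P : Matrix S S ℝ} {p : S → ℝ} {K : ℕ}
    {g : S → EuclideanSpace ℝ (Fin K) → EuclideanSpace ℝ (Fin K)} {L M ε : ℝ}
    (hP : P ∈ Matrix.rowStochastic ℝ S) (hirr : P.IsIrreducible) (hap : IsAperiodic P)
    (hp : IsStationary P p) (hL : ∀ s θ₁ θ₂, ‖g s θ₁ - g s θ₂‖ ≤ L * ‖θ₁ - θ₂‖)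
    (hM : ∀ s, ‖g s 0‖ ≤ M) (hL0 : 0 ≤ L) (hε : 0 < ε) : (mixingLags P p g ε).Nonempty := by
  -- `|M|` avoids a sign assumption on `M`; the `+ 1` makes `A` positive, so that `ε / A` is
  -- meaningful.
  set A := L + |M| + 1 with hA
  have hA0 : 0 < A := by positivity
  obtain ⟨N, hN⟩ := exists_forall_sum_abs_pow_sub_le hP hirr hap hp (div_pos hε hA0)
  refine ⟨N + 1, Nat.le_add_left 1 N, fun k hk θ s => ?_⟩
  have hg : ∀ x, ‖g x θ‖ ≤ A * (‖θ‖ + 1) := fun x => by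
    have h1 := norm_apply_le_of_lipschitz (hL x) (hM x) θ
    have h2 := le_abs_self M
    have h3 := mul_nonneg (abs_nonneg M) (norm_nonneg θ)
    have h4 := norm_nonneg θ
    rw [hA]
    nlinarith
  have heq : condMean P g k s θ - meanField p g θ = ∑ x, ((P ^ k) s x - p x) • g x θ := by
    simp [condMean, meanField, sub_smul]
  rw [heq]
  calc ‖∑ x, ((P ^ k) s x - p x) • g x θ‖
      ≤ ∑ x, |(P ^ k) s x - p x| * (A * (‖θ‖ + 1)) := by
        refine (norm_sum_le _ _).trans (Finset.sum_le_sum fun x _ => ?_)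
        rw [norm_smul, Real.norm_eq_abs]
        exact mul_le_mul_of_nonneg_left (hg x) (abs_nonneg _)
    _ = (∑ x, |(P ^ k) s x - p x|) * (A * (‖θ‖ + 1)) := (Finset.sum_mul _ _ _).symm
    _ ≤ ε / A * (A * (‖θ‖ + 1)) :=
        mul_le_mul_of_nonneg_right (hN k (by omega) s) (by positivity)
    _ = ε * (‖θ‖ + 1) := by field_simp

end Mixing

/-! ### The Markov property for functionals of finite paths. -/

section Path

variable {S : Type*}

/-- The path that follows `w` up to time `n` and stays at its last state from then on. -/
def extendPath {n : ℕ} (w : Fin (n + 1) → S) (i : ℕ) : S := w ⟨min i n, by omega⟩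

lemma extendPath_apply_of_le {n : ℕ} (x : ℕ → S) {i : ℕ} (hi : i ≤ n) :
    extendPath (fun j : Fin (n + 1) => x j) i = x i := by
  simp [extendPath, min_eq_left hi]

variable {Ω : Type*} [MeasurableSpace S] [MeasurableSpace Ω] {X : ℕ → Ω → S}

/-- Functions of finitely many steps of a finite-state process are integrable. -/
lemma integrable_of_dependsOn [Finite S] [MeasurableSingletonClass S] {μ : Measure Ω}
    [IsFiniteMeasure μ] (hX : ∀ t, Measurable (X t)) {n : ℕ} {F : (ℕ → S) → ℝ}
    (hF : DependsOn F (Set.Iic n)) : Integrable (fun ω => F fun t => X t ω) μ := by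
  have hY : Measurable fun ω => fun j : Fin (n + 1) => X j ω := measurable_pi_lambda _ fun j => hX j
  have h : Integrable (fun w : Fin (n + 1) → S => F (extendPath w))
      (μ.map fun ω => fun j : Fin (n + 1) => X j ω) := Integrable.of_finite
  convert h.comp_measurable hY using 2 with ω
  exact hF fun i hi => (extendPath_apply_of_le (fun t => X t ω) hi).symm

variable [Fintype S] [MeasurableSingletonClass S] {μ : Measure Ω} [IsFiniteMeasure μ]
  {P : Matrix S S ℝ}

/-- Both integrals are finite sums over path segments once pushed forward, and their atoms are
matched by `IsMarkovChain.step`. -/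
lemma IsMarkovChain.integral_succ (hX : IsMarkovChain P μ X) {n : ℕ} {F : (ℕ → S) → S → ℝ}
    (hF : DependsOn F (Set.Iic n)) :
    ∫ ω, F (fun t => X t ω) (X (n + 1) ω) ∂μ =
      ∫ ω, ∑ y, P (X n ω) y * F (fun t => X t ω) y ∂μ := by
  set Y : Ω → Fin (n + 1) → S := fun ω j => X j ω with hYdef
  have hY : Measurable Y := measurable_pi_lambda _ fun j => hX.measurable j
  have hZ : Measurable fun ω => (Y ω, X (n + 1) ω) := hY.prodMk (hX.measurable (n + 1))
  have hFY : ∀ ω, F (fun t => X t ω) = F (extendPath (Y ω)) := fun ω =>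
    hF fun i hi => (extendPath_apply_of_le (fun t => X t ω) hi).symm
  have hXn : ∀ ω, X n ω = Y ω (Fin.last n) := fun ω => rfl
  have hl : ∫ ω, F (fun t => X t ω) (X (n + 1) ω) ∂μ =
      ∫ z : (Fin (n + 1) → S) × S, F (extendPath z.1) z.2 ∂(μ.map fun ω => (Y ω, X (n + 1) ω)) := by
    rw [integral_map hZ.aemeasurable (by exact (Integrable.of_finite).aestronglyMeasurable)]
    simp only [hFY]
  have hr : ∫ ω, ∑ y, P (X n ω) y * F (fun t => X t ω) y ∂μ =
      ∫ w : Fin (n + 1) → S, ∑ y, P (w (Fin.last n)) y * F (extendPath w) y ∂(μ.map Y) := by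
    rw [integral_map hY.aemeasurable (by exact (Integrable.of_finite).aestronglyMeasurable)]
    simp only [hFY, hXn]
  rw [hl, hr, integral_fintype Integrable.of_finite, integral_fintype Integrable.of_finite,
    Fintype.sum_prod_type]
  refine Finset.sum_congr rfl fun w _ => ?_
  rw [smul_eq_mul, Finset.mul_sum]
  refine Finset.sum_congr rfl fun y _ => ?_
  rw [map_measureReal_apply hZ (measurableSet_singleton _),
    map_measureReal_apply hY (measurableSet_singleton _), smul_eq_mul, ← mul_assoc]
  congr 1
  set x : ℕ → S := fun i => if i ≤ n then extendPath w i else y with hx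
  have hxw : ∀ i : Fin (n + 1), x i = w i := fun i => by
    have hi : (i : ℕ) ≤ n := Nat.lt_succ_iff.1 i.2
    simp [hx, hi, extendPath]
  have h1 : {ω | ∀ i ≤ n, X i ω = x i} = Y ⁻¹' {w} := by
    ext ω
    simp only [Set.mem_ofPred_eq, Set.mem_preimage, Set.mem_singleton_iff, funext_iff]
    refine ⟨fun h i => ?_, fun h i hi => ?_⟩
    · rw [← hxw]
      exact h i (Nat.lt_succ_iff.1 i.2)
    · have := h ⟨i, Nat.lt_succ_of_le hi⟩
      rw [← hxw] at this
      exact this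
  have hxy : x (n + 1) = y := by simp [hx]
  have h2 : {ω | ∀ i ≤ n + 1, X i ω = x i} = (fun ω => (Y ω, X (n + 1) ω)) ⁻¹' {(w, y)} := by
    ext ω
    have h3 := Set.ext_iff.1 h1 ω
    simp only [Set.mem_ofPred_eq, Set.mem_preimage, Set.mem_singleton_iff, Prod.mk.injEq] at h3 ⊢
    rw [← h3, ← hxy]
    refine ⟨fun h => ⟨fun i hi => h i (by omega), h _ le_rfl⟩, fun h i hi => ?_⟩
    rcases Nat.le_succ_iff.1 hi with hi | rfl
    · exact h.1 i hi
    · exact h.2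
  have h := hX.step n x
  rw [h1, h2, hxy] at h
  have hxn : x n = w (Fin.last n) := hxw (Fin.last n)
  rw [h, hxn]

/-- The Markov property, at lag `k`, for functions of the past and one future state. -/
lemma IsMarkovChain.integral_add [DecidableEq S] (hX : IsMarkovChain P μ X) {n : ℕ} (k : ℕ)
    {F : (ℕ → S) → S → ℝ} (hF : DependsOn F (Set.Iic n)) :
    ∫ ω, F (fun t => X t ω) (X (n + k) ω) ∂μ =
      ∫ ω, ∑ y, (P ^ k) (X n ω) y * F (fun t => X t ω) y ∂μ := by
  induction k generalizing F with
  | zero => simp [Matrix.one_apply]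
  | succ k ih =>
    have hF' : DependsOn F (Set.Iic (n + k)) := fun x y h => hF fun i hi =>
      h i (Set.Iic_subset_Iic.2 (Nat.le_add_right n k) hi)
    -- Averaging out the last transition gives a new function of the past and one state, to which
    -- the induction hypothesis applies at lag `k`.
    rw [← add_assoc, hX.integral_succ hF',
      ih (F := fun x z => ∑ y, P z y * F x y) fun x y h => by simp only [hF h]]
    congr 1 with ω
    simp only [pow_succ, Matrix.mul_apply, Finset.sum_mul, Finset.mul_sum, mul_assoc]
    rw [Finset.sum_comm]

end Path

/-! ### Euclidean projection onto a compact convex set. -/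

section Projection

variable {K : ℕ} {B : Set (EuclideanSpace ℝ (Fin K))}

lemma proj_spec (hB : IsCompact B) (hne : B.Nonempty) (x : EuclideanSpace ℝ (Fin K)) :
    proj B x ∈ B ∧ ∀ z ∈ B, dist x (proj B x) ≤ dist x z := by
  obtain ⟨y, hy, hxy⟩ := hB.exists_isMinOn hne (f := fun z => dist x z) (by fun_prop)
  exact Classical.epsilon_spec (p := fun y => y ∈ B ∧ ∀ z ∈ B, dist x y ≤ dist x z)
    ⟨y, hy, fun z hz => hxy hz⟩

/-- The obtuse-angle characterization of the nearest point; convexity enters the proof only here. -/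
lemma inner_sub_proj_nonpos (hB : IsCompact B) (hconv : Convex ℝ B)
    {z : EuclideanSpace ℝ (Fin K)} (hz : z ∈ B) (x : EuclideanSpace ℝ (Fin K)) :
    inner ℝ (proj B x - z) (proj B x - x) ≤ 0 := by
  obtain ⟨hmem, hmin⟩ := proj_spec hB ⟨z, hz⟩ x
  have : Nonempty B := ⟨⟨z, hz⟩⟩
  have h : ‖x - proj B x‖ = ⨅ w : B, ‖x - w‖ := by
    refine le_antisymm (le_ciInf fun w => ?_) ?_
    · simpa [dist_eq_norm] using hmin w w.2
    · exact ciInf_le (f := fun w : B => ‖x - w‖)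
        ⟨0, by rintro _ ⟨w, rfl⟩; exact norm_nonneg _⟩ ⟨_, hmem⟩
  have h' := (norm_eq_iInf_iff_real_inner_le_zero hconv hmem).1 h z hz
  rwa [← inner_neg_neg, neg_sub, neg_sub, real_inner_comm]

end Projection

/-! ### Pathwise estimates for the error-feedback scheme. -/

section Deterministic

variable {K : ℕ}

/-- Square-root form of the compressor bound, from `1 - 1/δ ≤ (1 - 1/(2δ))²`; it makes the memory
recursion linear. -/
lemma IsCompressor.norm_sub_le {δ : ℝ} (hδ : 1 ≤ δ)
    {Q : EuclideanSpace ℝ (Fin K) → EuclideanSpace ℝ (Fin K)} (hQ : IsCompressor δ Q)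
    (v : EuclideanSpace ℝ (Fin K)) : ‖v - Q v‖ ≤ (1 - 1 / (2 * δ)) * ‖v‖ := by
  have hδ0 : 0 < δ := by linarith
  have h1 : 1 / (2 * δ) ≤ 1 := by
    rw [div_le_one (by positivity)]
    linarith
  have h2 : (1 - 1 / δ) ≤ (1 - 1 / (2 * δ)) ^ 2 := by
    have : (1 - 1 / (2 * δ)) ^ 2 = 1 - 1 / δ + (1 / (2 * δ)) ^ 2 := by
      field_simp
      ring
    rw [this]
    exact le_add_of_nonneg_right (sq_nonneg _)
  rw [norm_sub_rev]
  refine (sq_le_sq₀ (norm_nonneg _) (mul_nonneg (sub_nonneg.2 h1) (norm_nonneg _))).1 ?_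
  rw [mul_pow]
  exact (hQ v).trans (mul_le_mul_of_nonneg_right h2 (sq_nonneg _))

/-- One step of the scheme, seen on the virtual iterate `θ + α e`. -/
lemma norm_virtual_step_sq_le {α β δ σ : ℝ} {θ e γ h m θ' e' θs : EuclideanSpace ℝ (Fin K)}
    (hα : 0 < α) (hβ : 0 < β) (hαβ : α * β < 1) (hδ : 1 ≤ δ)
    (hγ : ‖γ‖ ≤ σ) (he : ‖e‖ ≤ 2 * δ * σ) (he' : ‖e'‖ ≤ 2 * δ * σ)
    (hr : ‖θ' - (θ + α • h)‖ ≤ 6 * α * δ * σ) (hinner : inner ℝ (θ' - θs) (θ' - (θ + α • h)) ≤ 0)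
    (hm : inner ℝ (θ - θs) m ≤ -β * ‖θ - θs‖ ^ 2) (heq : e' = e + γ - h) :
    ‖θ' + α • e' - θs‖ ^ 2 ≤ (1 - α * β) * ‖θ + α • e - θs‖ ^ 2
      + 2 * α * inner ℝ (θ - θs) (γ - m) + 37 * (α ^ 2 * δ ^ 2 * σ ^ 2) := by
  have hσ : 0 ≤ σ := (norm_nonneg _).trans hγ
  have hδ0 : 0 ≤ δ := by linarith
  set r := θ' - (θ + α • h) with hrdef
  set u := θ - θs with hu
  set d := θ + α • e - θs with hd
  have hdu : d = u + α • e := by rw [hd, hu]; abel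
  set d' := θ' + α • e' - θs with hd'
  have hd'u : d' = (θ' - θs) + α • e' := by rw [hd']; abel
  -- The compressed update `h` cancels: only the true update and the projection residual `r` move
  -- the virtual iterate.
  have hdd : d + α • γ = d' - r := by
    rw [hd, hd', hrdef, heq, smul_sub, smul_add]
    abel
  have h1 : ‖d + α • γ‖ ^ 2 = ‖d'‖ ^ 2 - 2 * inner ℝ d' r + ‖r‖ ^ 2 := by
    rw [hdd, norm_sub_sq_real]
  have h2 : ‖d + α • γ‖ ^ 2 = ‖d‖ ^ 2 + 2 * (α * inner ℝ d γ) + α ^ 2 * ‖γ‖ ^ 2 := by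
    rw [norm_add_sq_real, norm_smul, mul_pow, Real.norm_eq_abs, sq_abs, inner_smul_right]
  -- The part of `d'` along `θ' - θs` contributes nonpositively, leaving only the memory term, which
  -- is of order `α²`.
  have h3 : inner ℝ d' r ≤ 12 * (α ^ 2 * δ ^ 2 * σ ^ 2) := by
    rw [hd'u, inner_add_left, real_inner_smul_left]
    have h4 : inner ℝ e' r ≤ 2 * δ * σ * (6 * α * δ * σ) :=
      (real_inner_le_norm _ _).trans (mul_le_mul he' hr (norm_nonneg _) (by positivity))
    have h5 := mul_le_mul_of_nonneg_left h4 hα.le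
    linear_combination h5 + hinner
  have h4 : inner ℝ d γ ≤ inner ℝ u (γ - m) - β * ‖u‖ ^ 2 + α * (2 * δ * σ ^ 2) := by
    rw [hdu, inner_add_left, real_inner_smul_left, inner_sub_right]
    have h5 : inner ℝ e γ ≤ 2 * δ * σ * σ :=
      (real_inner_le_norm _ _).trans (mul_le_mul he hγ (norm_nonneg _) (by positivity))
    have h6 := mul_le_mul_of_nonneg_left h5 hα.le
    linear_combination h6 + hm
  have hee : ‖e‖ ^ 2 ≤ 4 * (δ ^ 2 * σ ^ 2) := by
    have := pow_le_pow_left₀ (norm_nonneg e) he 2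
    linear_combination this
  -- Half of the monotonicity gain `2αβ‖u‖²` is lost in passing from the true error `u` to the
  -- virtual error `d`.
  have h5 : ‖d‖ ^ 2 ≤ 2 * ‖u‖ ^ 2 + 8 * (α ^ 2 * δ ^ 2 * σ ^ 2) := by
    have h6 : ‖d‖ ^ 2 ≤ 2 * (‖u‖ ^ 2 + (α * ‖e‖) ^ 2) := by
      have h7 : ‖d‖ ≤ ‖u‖ + α * ‖e‖ := by
        rw [hdu]
        refine (norm_add_le _ _).trans_eq ?_
        rw [norm_smul, Real.norm_eq_abs, abs_of_pos hα]
      exact (pow_le_pow_left₀ (norm_nonneg _) h7 2).trans add_sq_le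
    have h7 := mul_le_mul_of_nonneg_left hee (sq_nonneg α)
    linear_combination h6 + 2 * h7
  have h6 : α * β * ‖d‖ ^ 2 ≤ 2 * (α * β * ‖u‖ ^ 2) + 8 * (α ^ 2 * δ ^ 2 * σ ^ 2) := by
    have hab : 0 ≤ α * β := by positivity
    have h7 := mul_le_mul_of_nonneg_left h5 hab
    have h8 : α * β * (8 * (α ^ 2 * δ ^ 2 * σ ^ 2)) ≤ 1 * (8 * (α ^ 2 * δ ^ 2 * σ ^ 2)) :=
      mul_le_mul_of_nonneg_right hαβ.le (by positivity)
    linear_combination h7 + h8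
  have h7 : ‖γ‖ ^ 2 ≤ σ ^ 2 := pow_le_pow_left₀ (norm_nonneg _) hγ 2
  have h8 := mul_le_mul_of_nonneg_left h7 (sq_nonneg α)
  have h9 := mul_le_mul_of_nonneg_left h4 hα.le
  have h10 := sq_nonneg ‖r‖
  have h11 : α ^ 2 * σ ^ 2 ≤ α ^ 2 * δ ^ 2 * σ ^ 2 := by
    have : 1 ≤ δ ^ 2 := one_le_pow₀ hδ
    have := mul_le_mul_of_nonneg_left this (by positivity : 0 ≤ α ^ 2 * σ ^ 2)
    linarith
  have h12 : α ^ 2 * (δ * σ ^ 2) ≤ α ^ 2 * δ ^ 2 * σ ^ 2 := by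
    have : δ ≤ δ ^ 2 := le_self_pow₀ hδ two_ne_zero
    have := mul_le_mul_of_nonneg_left this (by positivity : 0 ≤ α ^ 2 * σ ^ 2)
    linarith
  -- Here `37 = 24 + 8 + 1 + 4`, from `2 * h3`, `h6`, `h8` and `2 * h9`.
  linear_combination h2 - h1 + 2 * h3 + h6 + h8 + h11 + 4 * h12 + 2 * h9 + h10

variable {S : Type*} {g : S → EuclideanSpace ℝ (Fin K) → EuclideanSpace ℝ (Fin K)}
  {Q : EuclideanSpace ℝ (Fin K) → EuclideanSpace ℝ (Fin K)} {B : Set (EuclideanSpace ℝ (Fin K))}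
  {α δ σ : ℝ} {θ₀ : EuclideanSpace ℝ (Fin K)}

lemma efState_dependsOn (t : ℕ) : DependsOn (fun x : ℕ → S => efState g Q B α θ₀ x t)
    (Set.Iio t) := by
  induction t with
  | zero => exact fun _ _ _ => rfl
  | succ t ih =>
    intro x y h
    have h1 : efState g Q B α θ₀ x t = efState g Q B α θ₀ y t :=
      ih fun i hi => h i (Set.Iio_subset_Iio (Nat.le_succ t) hi)
    have h2 : x t = y t := h t (Nat.lt_succ_self t)
    simp only [efState, h1, h2]

lemma efIterate_mem (hB : IsCompact B) (h0 : θ₀ ∈ B) (x : ℕ → S) (t : ℕ) :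
    efIterate g Q B α θ₀ x t ∈ B := by
  cases t with
  | zero => exact h0
  | succ t => exact (proj_spec hB ⟨_, h0⟩ _).1

/-- The memory of the error-feedback scheme stays bounded. -/
lemma norm_efState_snd_le (hδ : 1 ≤ δ) (hQ : IsCompressor δ Q) (hB : IsCompact B) (h0 : θ₀ ∈ B)
    (hg : ∀ s, ∀ θ ∈ B, ‖g s θ‖ ≤ σ) (x : ℕ → S) (t : ℕ) :
    ‖(efState g Q B α θ₀ x t).2‖ ≤ 2 * δ * σ := by
  have hσ : 0 ≤ σ := (norm_nonneg _).trans (hg (x 0) _ h0)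
  have hδ0 : 0 < δ := by linarith
  induction t with
  | zero =>
    simp only [efState, norm_zero]
    positivity
  | succ t ih =>
    have hmem := hg (x t) _ (efIterate_mem (g := g) (Q := Q) (α := α) hB h0 x t)
    have h1 : 1 / (2 * δ) ≤ 1 := by
      rw [div_le_one (by positivity)]
      linarith
    refine (hQ.norm_sub_le hδ _).trans ?_
    -- The radius `2δσ` is invariant: the contraction of `2δσ + σ` removes `σ + σ/(2δ)`.
    calc (1 - 1 / (2 * δ)) * _ ≤ (1 - 1 / (2 * δ)) * (2 * δ * σ + σ) :=
          mul_le_mul_of_nonneg_left ((norm_add_le _ _).trans (add_le_add ih hmem))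
            (sub_nonneg.2 h1)
      _ = 2 * δ * σ - 1 / (2 * δ) * σ := by
          field_simp
          ring
      _ ≤ 2 * δ * σ := sub_le_self _ (by positivity)

/-- The compressed vector is `e + γ - e'`, where both memories are already bounded. -/
lemma norm_compressed_le (hδ : 1 ≤ δ) (hQ : IsCompressor δ Q) (hB : IsCompact B) (h0 : θ₀ ∈ B)
    (hg : ∀ s, ∀ θ ∈ B, ‖g s θ‖ ≤ σ) (x : ℕ → S) (t : ℕ) :
    ‖Q ((efState g Q B α θ₀ x t).2 + g (x t) (efIterate g Q B α θ₀ x t))‖ ≤ 6 * δ * σ := by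
  have hσ : 0 ≤ σ := (norm_nonneg _).trans (hg (x 0) _ h0)
  have hmem := hg (x t) _ (efIterate_mem (g := g) (Q := Q) (α := α) hB h0 x t)
  have he := norm_efState_snd_le (α := α) hδ hQ hB h0 hg x t
  have he' := norm_efState_snd_le (α := α) hδ hQ hB h0 hg x (t + 1)
  set e := (efState g Q B α θ₀ x t).2
  set γ := g (x t) (efIterate g Q B α θ₀ x t)
  have h1 : (efState g Q B α θ₀ x (t + 1)).2 = e + γ - Q (e + γ) := rfl
  have h2 : Q (e + γ) = e + γ - (efState g Q B α θ₀ x (t + 1)).2 := by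
    rw [h1]
    abel
  rw [h2]
  have h3 := norm_sub_le (e + γ) (efState g Q B α θ₀ x (t + 1)).2
  have h4 := norm_add_le e γ
  have h5 : σ ≤ δ * σ := le_mul_of_one_le_left hσ hδ
  linarith

/-- The current iterate lies in `B`, so the nearest point is no farther away than `α‖h‖`. -/
lemma norm_proj_sub_le (hδ : 1 ≤ δ) (hQ : IsCompressor δ Q) (hB : IsCompact B) (h0 : θ₀ ∈ B)
    (hg : ∀ s, ∀ θ ∈ B, ‖g s θ‖ ≤ σ) (hα : 0 < α) (x : ℕ → S) (t : ℕ) :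
    ‖efIterate g Q B α θ₀ x (t + 1) - (efIterate g Q B α θ₀ x t +
      α • Q ((efState g Q B α θ₀ x t).2 + g (x t) (efIterate g Q B α θ₀ x t)))‖
      ≤ 6 * α * δ * σ := by
  have h1 := norm_compressed_le (α := α) hδ hQ hB h0 hg x t
  have hmem := efIterate_mem (g := g) (Q := Q) (α := α) hB h0 x t
  set h := Q ((efState g Q B α θ₀ x t).2 + g (x t) (efIterate g Q B α θ₀ x t))
  have h2 : efIterate g Q B α θ₀ x (t + 1) = proj B (efIterate g Q B α θ₀ x t + α • h) := rfl
  have h3 := (proj_spec hB ⟨_, h0⟩ (efIterate g Q B α θ₀ x t + α • h)).2 _ hmem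
  rw [← h2, dist_comm, dist_eq_norm, dist_eq_norm, add_sub_cancel_left, norm_smul,
    Real.norm_eq_abs, abs_of_pos hα] at h3
  have h4 := mul_le_mul_of_nonneg_left h1 hα.le
  linarith

lemma norm_efIterate_succ_sub_le (hδ : 1 ≤ δ) (hQ : IsCompressor δ Q) (hB : IsCompact B)
    (h0 : θ₀ ∈ B) (hg : ∀ s, ∀ θ ∈ B, ‖g s θ‖ ≤ σ) (hα : 0 < α) (x : ℕ → S) (t : ℕ) :
    ‖efIterate g Q B α θ₀ x (t + 1) - efIterate g Q B α θ₀ x t‖ ≤ 12 * α * δ * σ := by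
  have h1 := norm_compressed_le (α := α) hδ hQ hB h0 hg x t
  have h2 := norm_proj_sub_le hδ hQ hB h0 hg hα x t
  set h := Q ((efState g Q B α θ₀ x t).2 + g (x t) (efIterate g Q B α θ₀ x t))
  have h3 : efIterate g Q B α θ₀ x (t + 1) - efIterate g Q B α θ₀ x t =
      (efIterate g Q B α θ₀ x (t + 1) - (efIterate g Q B α θ₀ x t + α • h)) + α • h := by abel
  rw [h3]
  refine (norm_add_le _ _).trans ?_
  rw [norm_smul, Real.norm_eq_abs, abs_of_pos hα]
  have h4 := mul_le_mul_of_nonneg_left h1 hα.le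
  linarith

lemma norm_efIterate_add_sub_le (hδ : 1 ≤ δ) (hQ : IsCompressor δ Q) (hB : IsCompact B)
    (h0 : θ₀ ∈ B) (hg : ∀ s, ∀ θ ∈ B, ‖g s θ‖ ≤ σ) (hα : 0 < α) (x : ℕ → S) (n k : ℕ) :
    ‖efIterate g Q B α θ₀ x (n + k) - efIterate g Q B α θ₀ x n‖ ≤ k * (12 * α * δ * σ) := by
  induction k with
  | zero => simp
  | succ k ih =>
    have h1 := norm_efIterate_succ_sub_le hδ hQ hB h0 hg hα x (n + k)
    have h2 := norm_sub_le_norm_sub_add_norm_sub (efIterate g Q B α θ₀ x (n + k + 1))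
      (efIterate g Q B α θ₀ x (n + k)) (efIterate g Q B α θ₀ x n)
    rw [← add_assoc]
    push_cast
    linarith

end Deterministic

/-! ### Lipschitz dependence of the Markov bias on the parameter. -/

section Bias

variable {S : Type*} [Fintype S] {K : ℕ} {p : S → ℝ}
  {g : S → EuclideanSpace ℝ (Fin K) → EuclideanSpace ℝ (Fin K)}
  {B : Set (EuclideanSpace ℝ (Fin K))} {L G σ : ℝ} {θs : EuclideanSpace ℝ (Fin K)}

/-- The bias incurred by the observation `s` at the parameter `θ`. -/
def bias (p : S → ℝ) (g : S → EuclideanSpace ℝ (Fin K) → EuclideanSpace ℝ (Fin K))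
    (θs θ : EuclideanSpace ℝ (Fin K)) (s : S) : ℝ :=
  inner ℝ (θ - θs) (g s θ - meanField p g θ)

lemma norm_sum_smul_le (hp : p ∈ stdSimplex ℝ S) {v : S → EuclideanSpace ℝ (Fin K)} {c : ℝ}
    (hv : ∀ s, ‖v s‖ ≤ c) : ‖∑ s, p s • v s‖ ≤ c := by
  calc ‖∑ s, p s • v s‖ ≤ ∑ s, p s * c := by
        refine (norm_sum_le _ _).trans (Finset.sum_le_sum fun s _ => ?_)
        rw [norm_smul, Real.norm_eq_abs, abs_of_nonneg (hp.1 s)]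
        exact mul_le_mul_of_nonneg_left (hv s) (hp.1 s)
    _ = c := by rw [← Finset.sum_mul, hp.2, one_mul]

/-- Product rule: varying the first factor costs `2σ`, varying the second costs `2G · 2L ≤ 4σ`. -/
lemma bias_sub_le (hp : p ∈ stdSimplex ℝ S) (hL : ∀ s θ₁ θ₂, ‖g s θ₁ - g s θ₂‖ ≤ L * ‖θ₁ - θ₂‖)
    (hG : ∀ θ ∈ B, ‖θ‖ ≤ G) (hg : ∀ s, ∀ θ ∈ B, ‖g s θ‖ ≤ σ) (hLσ : L * G ≤ σ) (hs : θs ∈ B)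
    {θ θ' : EuclideanSpace ℝ (Fin K)} (hθ : θ ∈ B) (hθ' : θ' ∈ B) (s : S) :
    bias p g θs θ s ≤ bias p g θs θ' s + 6 * σ * ‖θ - θ'‖ := by
  have h1 : bias p g θs θ s - bias p g θs θ' s =
      inner ℝ (θ - θ') (g s θ - meanField p g θ) +
      inner ℝ (θ' - θs) ((g s θ - g s θ') - (meanField p g θ - meanField p g θ')) := by
    simp only [bias, inner_sub_left, inner_sub_right]
    ring
  have hm : ‖meanField p g θ‖ ≤ σ := norm_sum_smul_le hp fun s => hg s θ hθ
  have hml : ‖meanField p g θ - meanField p g θ'‖ ≤ L * ‖θ - θ'‖ := by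
    have : meanField p g θ - meanField p g θ' = ∑ s, p s • (g s θ - g s θ') := by
      simp [meanField, smul_sub]
    rw [this]
    exact norm_sum_smul_le hp fun s => hL s θ θ'
  have h2 : inner ℝ (θ - θ') (g s θ - meanField p g θ) ≤ ‖θ - θ'‖ * (2 * σ) := by
    refine (real_inner_le_norm _ _).trans (mul_le_mul_of_nonneg_left ?_ (norm_nonneg _))
    have := norm_sub_le (g s θ) (meanField p g θ)
    have := hg s θ hθ
    linarith
  have h3 : inner ℝ (θ' - θs) ((g s θ - g s θ') - (meanField p g θ - meanField p g θ')) ≤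
      2 * G * (2 * (L * ‖θ - θ'‖)) := by
    refine (real_inner_le_norm _ _).trans (mul_le_mul ?_ ?_ (norm_nonneg _) ?_)
    · have := norm_sub_le θ' θs
      have := hG _ hθ'
      have := hG _ hs
      linarith
    · have := norm_sub_le (g s θ - g s θ') (meanField p g θ - meanField p g θ')
      have := hL s θ θ'
      linarith
    · have := (norm_nonneg _).trans (hG _ hs)
      linarith
  have h4 := mul_le_mul_of_nonneg_right hLσ (norm_nonneg (θ - θ'))
  linarith

end Bias

/-! ### The mean bias after one mixing time, and the scalar recursion. -/

section Expectation

variable {S : Type*} [Fintype S] [DecidableEq S] [MeasurableSpace S] [MeasurableSingletonClass S]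
  {Ω : Type*} [MeasurableSpace Ω] {μ : Measure Ω} [IsProbabilityMeasure μ]
  {P : Matrix S S ℝ} {p : S → ℝ} {X : ℕ → Ω → S} {K : ℕ}
  {g : S → EuclideanSpace ℝ (Fin K) → EuclideanSpace ℝ (Fin K)}
  {B : Set (EuclideanSpace ℝ (Fin K))} {θs : EuclideanSpace ℝ (Fin K)} {α G : ℝ}

/-- After a full mixing time, the bias at a parameter fixed by the past is small on average. -/
lemma integral_bias_le (hX : IsMarkovChain P μ X) (hP : P ∈ Matrix.rowStochastic ℝ S) {τ : ℕ}
    (hτ : τ ∈ mixingLags P p g α) (hα : 0 < α) (hG1 : 1 ≤ G) (hG : ∀ θ ∈ B, ‖θ‖ ≤ G)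
    (hs : θs ∈ B) {n : ℕ} {ψ : (ℕ → S) → EuclideanSpace ℝ (Fin K)}
    (hψ : DependsOn ψ (Set.Iic n)) (hψB : ∀ x, ψ x ∈ B) :
    ∫ ω, bias p g θs (ψ fun t => X t ω) (X (n + τ) ω) ∂μ ≤ 4 * α * G ^ 2 := by
  rw [hX.integral_add τ (F := fun x s => bias p g θs (ψ x) s) fun x y h => by simp only [hψ h]]
  have hpt : ∀ ω, ∑ y, (P ^ τ) (X n ω) y * bias p g θs (ψ fun t => X t ω) y ≤ 4 * α * G ^ 2 := by
    intro ω
    have hθ := hψB fun t => X t ω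
    set θ := ψ fun t => X t ω
    have h1 : ∑ y, (P ^ τ) (X n ω) y * bias p g θs θ y =
        inner ℝ (θ - θs) (condMean P g τ (X n ω) θ - meanField p g θ) := by
      have hsum := Matrix.sum_row_of_mem_rowStochastic (pow_mem hP τ) (X n ω)
      simp only [bias, inner_sub_right, condMean, inner_sum, inner_smul_right, mul_sub,
        Finset.sum_sub_distrib]
      rw [← Finset.sum_mul, hsum, one_mul]
    rw [h1]
    have h2 : ‖θ - θs‖ ≤ 2 * G := by
      have := norm_sub_le θ θs
      have := hG _ hθ
      have := hG _ hs
      linarith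
    -- `1 ≤ G` turns `‖θ‖ + 1` into `2G`.
    have h3 : ‖condMean P g τ (X n ω) θ - meanField p g θ‖ ≤ α * (2 * G) := by
      refine (hτ.2 τ le_rfl θ (X n ω)).trans (mul_le_mul_of_nonneg_left ?_ hα.le)
      have := hG _ hθ
      linarith
    refine (real_inner_le_norm _ _).trans ((mul_le_mul h2 h3 (norm_nonneg _) ?_).trans_eq ?_)
    · linarith
    · ring
  have hint : Integrable (fun ω => ∑ y, (P ^ τ) (X n ω) y * bias p g θs (ψ fun t => X t ω) y) μ :=
    integrable_of_dependsOn (F := fun x => ∑ y, (P ^ τ) (x n) y * bias p g θs (ψ x) y)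
      hX.measurable (n := n) fun x y h => by
        have hn : x n = y n := h n (Set.mem_Iic.2 le_rfl)
        simp only [hψ h, hn]
  refine (integral_mono hint (integrable_const (4 * α * G ^ 2)) hpt).trans_eq ?_
  simp

end Expectation

/-- A geometric recursion with a constant perturbation. -/
lemma le_geometric_of_succ_le {a : ℕ → ℝ} {q c : ℝ} (hq : q < 1) (hq0 : 0 ≤ q) (hc : 0 ≤ c)
    {τ : ℕ} (h : ∀ t ≥ τ, a (t + 1) ≤ q * a t + c) :
    ∀ T ≥ τ, a T ≤ q ^ (T - τ) * a τ + c / (1 - q) := by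
  intro T hT
  have hq1 : 0 < 1 - q := by linarith
  induction T, hT using Nat.le_induction with
  | base =>
    have := div_nonneg hc hq1.le
    simpa using this
  | succ t ht ih =>
    have h1 := mul_le_mul_of_nonneg_left ih hq0
    -- `c / (1 - q)` is the fixed point of `a ↦ q a + c`.
    have h2 : c / (1 - q) = q * (c / (1 - q)) + c := by
      field_simp
      ring
    have h3 := h t ht
    rw [Nat.succ_sub ht, pow_succ, h2]
    linear_combination h3 + h1

end EFSA

end

/-! ### Assembly of the bound. -/

open EFSA in
theorem theorem4 (L : ℝ) (hL : 0 < L) (M : ℝ) :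
    ∃ C : ℝ, 0 < C ∧
      ∀ (S : Type*) [Fintype S] [DecidableEq S] [MeasurableSpace S] [MeasurableSingletonClass S]
        (Ω : Type*) [MeasurableSpace Ω] (μ : Measure Ω) [IsProbabilityMeasure μ]
        (P : Matrix S S ℝ) (p : S → ℝ) (X : ℕ → Ω → S) (K : ℕ)
        (g : S → EuclideanSpace ℝ (Fin K) → EuclideanSpace ℝ (Fin K))
        (Q : EuclideanSpace ℝ (Fin K) → EuclideanSpace ℝ (Fin K))
        (B : Set (EuclideanSpace ℝ (Fin K))) (θ₀ θs : EuclideanSpace ℝ (Fin K))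
        (α β δ G : ℝ),
        -- the Markovian data: an irreducible aperiodic chain with stationary law `p`
        P ∈ Matrix.rowStochastic ℝ S → P.IsIrreducible → EFSA.IsAperiodic P →
        EFSA.IsStationary P p → EFSA.IsMarkovChain P μ X →
        -- the update map: uniformly Lipschitz, with bounded offset
        (∀ s θ₁ θ₂, ‖g s θ₁ - g s θ₂‖ ≤ L * ‖θ₁ - θ₂‖) → (∀ s, ‖g s 0‖ ≤ M) →
        -- strong monotonicity around a root
        EFSA.meanField p g θs = 0 → 0 < β →
        (∀ θ, inner ℝ (θ - θs) (EFSA.meanField p g θ - EFSA.meanField p g θs) ≤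
          -β * ‖θ - θs‖ ^ 2) →
        -- the compression operator and the projection set of radius `G`
        1 ≤ δ → EFSA.IsCompressor δ Q →
        Convex ℝ B → IsCompact B → 1 ≤ G → (∀ θ ∈ B, ‖θ‖ ≤ G) → θs ∈ B → θ₀ ∈ B →
        -- the step size
        0 < α → α < 1 → α * β < 1 →
        ∃ τ : ℕ, IsLeast (EFSA.mixingLags P p g α) τ ∧
          ∀ T ≥ τ,
            Integrable (fun ω => ‖EFSA.efIterate g Q B α θ₀ (fun t => X t ω) T - θs‖ ^ 2) μ ∧
            ∫ ω, ‖EFSA.efIterate g Q B α θ₀ (fun t => X t ω) T - θs‖ ^ 2 ∂μ ≤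
              C * (α ^ 2 * δ ^ 2 * G ^ 2 + G ^ 2) * (1 - α * β) ^ (T - τ) +
                C * (α * τ * δ ^ 2 * G ^ 2 / β) := by
  -- With `A = L + |M|`, the transient needs `16 + 16 A²` and the stationary term `16 + 370 A²`;
  -- `400 (A² + 1)` covers both.
  refine ⟨400 * ((L + |M|) ^ 2 + 1), by positivity, ?_⟩
  intro S _ _ _ _ Ω _ μ _ P p X K g Q B θ₀ θs α β δ G hP hirr hap hp hX hgL hgM hroot hβ hmono hδ hQ
    hconv hB hG1 hG hs h0 hα _ hαβ
  refine ⟨_, ⟨Nat.sInf_mem (mixingLags_nonempty hP hirr hap hp hgL hgM hL.le hα),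
    fun k hk => Nat.sInf_le hk⟩, ?_⟩
  have hτ := Nat.sInf_mem (mixingLags_nonempty hP hirr hap hp hgL hgM hL.le hα)
  set τ := sInf (mixingLags P p g α)
  have hτ1 : (1 : ℝ) ≤ τ := by exact_mod_cast hτ.1
  set A := L + |M| with hA
  have hG0 : 0 < G := by linarith
  have hA0 : 0 < A := by positivity
  have hδ0 : 0 < δ := by linarith
  have hg : ∀ s, ∀ θ ∈ B, ‖g s θ‖ ≤ A * G := fun s θ hθ => by
    have h1 := norm_apply_le_of_lipschitz (hgL s) (hgM s) θ
    have h2 := mul_le_mul_of_nonneg_left (hG θ hθ) hL.le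
    have h3 := le_abs_self M
    have h4 := le_mul_of_one_le_right (abs_nonneg M) hG1
    rw [hA, add_mul]
    linarith
  have hLG : L * G ≤ A * G :=
    mul_le_mul_of_nonneg_right (le_add_of_nonneg_right (abs_nonneg M)) hG0.le
  set θ : ℕ → (ℕ → S) → EuclideanSpace ℝ (Fin K) := fun t x => efIterate g Q B α θ₀ x t with hθdef
  set e : ℕ → (ℕ → S) → EuclideanSpace ℝ (Fin K) := fun t x => (efState g Q B α θ₀ x t).2 with hedef
  have hdep : ∀ n t, t ≤ n + 1 →
      DependsOn (fun x : ℕ → S => efState g Q B α θ₀ x t) (Set.Iic n) := fun n t ht x y h =>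
    efState_dependsOn t fun i hi => h i (by
      have : i < t := hi
      exact Set.mem_Iic.2 (by omega))
  have hθB : ∀ t x, θ t x ∈ B := fun t x => efIterate_mem hB h0 x t
  have heb : ∀ t x, ‖e t x‖ ≤ 2 * δ * (A * G) := fun t x => norm_efState_snd_le hδ hQ hB h0 hg x t
  set D : ℕ → (ℕ → S) → ℝ := fun t x => ‖θ t x + α • e t x - θs‖ ^ 2 with hD
  set N : ℝ := α ^ 2 * δ ^ 2 * (A * G) ^ 2 with hN
  have hN0 : 0 ≤ N := by positivity
  -- The bias is frozen at `t - τ`. Its cost is `2α · 6AG · τ · 12αδAG`, at most `144 τ N` because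
  -- `δ ≤ δ²`.
  have hstep : ∀ t ≥ τ, ∀ x, D (t + 1) x ≤ (1 - α * β) * D t x
      + 2 * α * bias p g θs (θ (t - τ) x) (x t) + (144 * τ + 37) * N := by
    intro t ht x
    have h1 : D (t + 1) x ≤ (1 - α * β) * D t x + 2 * α * bias p g θs (θ t x) (x t) + 37 * N := by
      have hm := hmono (θ t x)
      rw [hroot, sub_zero] at hm
      exact norm_virtual_step_sq_le hα hβ hαβ hδ (hg (x t) _ (hθB t x)) (heb t x) (heb (t + 1) x)
        (norm_proj_sub_le hδ hQ hB h0 hg hα x t) (inner_sub_proj_nonpos hB hconv hs _) hm rfl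
    have h2 := bias_sub_le hp.1 hgL hG hg hLG hs (hθB t x) (hθB (t - τ) x) (x t)
    have h3 := norm_efIterate_add_sub_le hδ hQ hB h0 hg hα x (t - τ) τ
    rw [Nat.sub_add_cancel ht] at h3
    have h4 := mul_le_mul_of_nonneg_left h3 (by positivity : 0 ≤ 6 * (A * G))
    have h5 := mul_le_mul_of_nonneg_left (h2.trans (add_le_add_right h4 _))
      (by positivity : 0 ≤ 2 * α)
    have h6 : α ^ 2 * (δ * (A * G) ^ 2) * τ ≤ N * τ := by
      refine mul_le_mul_of_nonneg_right ?_ (by linarith)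
      have h7 := mul_le_mul_of_nonneg_left (le_self_pow₀ hδ two_ne_zero)
        (by positivity : 0 ≤ α ^ 2 * (A * G) ^ 2)
      rw [hN]
      linarith
    linear_combination h1 + h5 + 144 * h6
  have hint : ∀ {F : (ℕ → S) → ℝ} (n : ℕ), DependsOn F (Set.Iic n) →
      Integrable (fun ω => F fun t => X t ω) μ := fun n hF => integrable_of_dependsOn hX.measurable hF
  have hDint : ∀ t, Integrable (fun ω => D t fun t => X t ω) μ := fun t =>
    hint (F := D t) t fun x y h => by
      have := hdep t t (Nat.le_succ t) h
      simp only [hD, hθdef, hedef, efIterate, this]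
  set a : ℕ → ℝ := fun t => ∫ ω, D t (fun t => X t ω) ∂μ with ha
  have hrec : ∀ t ≥ τ, a (t + 1) ≤ (1 - α * β) * a t + (8 * α ^ 2 * G ^ 2 + (144 * τ + 37) * N) := by
    intro t ht
    have hψ : ∀ n, DependsOn (θ n) (Set.Iic n) := fun n x y h => by
      have := hdep n n (Nat.le_succ n) h
      simp only [hθdef, efIterate, this]
    have hb := integral_bias_le hX hP hτ hα hG1 hG hs (hψ (t - τ)) (hθB (t - τ))
    rw [Nat.sub_add_cancel ht] at hb
    have hbint : Integrable
        (fun ω => bias p g θs (θ (t - τ) fun t => X t ω) (X t ω)) μ :=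
      hint (F := fun x => bias p g θs (θ (t - τ) x) (x t)) t fun x y h => by
        have h1 := hψ (t - τ) (fun i hi => h i (Set.Iic_subset_Iic.2 (Nat.sub_le t τ) hi))
        have h2 : x t = y t := h t (Set.mem_Iic.2 le_rfl)
        simp only [h1, h2]
    have hi1 : Integrable (fun ω => (1 - α * β) * D t fun t => X t ω) μ := (hDint t).const_mul _
    have hi2 : Integrable
        (fun ω => 2 * α * bias p g θs (θ (t - τ) fun t => X t ω) (X t ω)) μ := hbint.const_mul _
    have hi12 : Integrable (fun ω => (1 - α * β) * D t (fun t => X t ω)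
        + 2 * α * bias p g θs (θ (t - τ) fun t => X t ω) (X t ω)) μ := hi1.add hi2
    have h1 : a (t + 1) ≤ ∫ ω, ((1 - α * β) * D t (fun t => X t ω)
        + 2 * α * bias p g θs (θ (t - τ) fun t => X t ω) (X t ω) + (144 * τ + 37) * N) ∂μ :=
      integral_mono (hDint (t + 1)) (hi12.add (integrable_const _)) fun ω => hstep t ht fun t => X t ω
    rw [integral_add hi12 (integrable_const _), integral_add hi1 hi2, integral_const_mul,
      integral_const_mul, integral_const, probReal_univ, one_smul] at h1
    have h2 := mul_le_mul_of_nonneg_left hb (by positivity : 0 ≤ 2 * α)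
    linear_combination h1 + h2
  intro T hT
  have hTint : Integrable (fun ω => ‖θ T (fun t => X t ω) - θs‖ ^ 2) μ :=
    hint (F := fun x => ‖θ T x - θs‖ ^ 2) T fun x y h => by
      have := hdep T T (Nat.le_succ T) h
      simp only [hθdef, efIterate, this]
  refine ⟨hTint, ?_⟩
  have hαe : ∀ t x, ‖α • e t x‖ ^ 2 ≤ 4 * N := fun t x => by
    have h1 := pow_le_pow_left₀ (norm_nonneg _) (heb t x) 2
    have h2 := mul_le_mul_of_nonneg_left h1 (sq_nonneg α)
    rw [norm_smul, mul_pow, Real.norm_eq_abs, sq_abs]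
    linear_combination h2
  have hfin : ∫ ω, ‖θ T (fun t => X t ω) - θs‖ ^ 2 ∂μ ≤ 2 * a T + 8 * N := by
    have h1 : ∀ x, ‖θ T x - θs‖ ^ 2 ≤ 2 * D T x + 8 * N := fun x => by
      have h2 : θ T x - θs = (θ T x + α • e T x - θs) - α • e T x := by abel
      have h3 := pow_le_pow_left₀ (norm_nonneg _) (norm_sub_le (θ T x + α • e T x - θs) (α • e T x)) 2
      rw [← h2] at h3
      have h4 := h3.trans add_sq_le
      have h5 := hαe T x
      linear_combination h4 + 2 * h5
    refine (integral_mono hTint (((hDint T).const_mul 2).add (integrable_const (8 * N)))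
      fun ω => h1 fun t => X t ω).trans_eq ?_
    simp only [Pi.add_apply]
    rw [integral_add ((hDint T).const_mul 2) (integrable_const _), integral_const_mul,
      integral_const, probReal_univ, one_smul]
  -- Before time `τ` the recursion is unavailable; the boundedness of `B` and of the memory suffices
  -- there.
  have hinit : a τ ≤ 8 * G ^ 2 + 8 * N := by
    have h1 : ∀ x, D τ x ≤ 8 * G ^ 2 + 8 * N := fun x => by
      have h2 : θ τ x + α • e τ x - θs = (θ τ x - θs) + α • e τ x := by abel
      have h3 := pow_le_pow_left₀ (norm_nonneg _) (norm_add_le (θ τ x - θs) (α • e τ x)) 2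
      rw [← h2] at h3
      have h4 := h3.trans add_sq_le
      have h5 := hαe τ x
      have h6 : ‖θ τ x - θs‖ ≤ 2 * G := by
        have := norm_sub_le (θ τ x) θs
        have := hG _ (hθB τ x)
        have := hG _ hs
        linarith
      have h7 := pow_le_pow_left₀ (norm_nonneg _) h6 2
      linear_combination h4 + 2 * h5 + 2 * h7
    refine (integral_mono (hDint τ) (integrable_const (8 * G ^ 2 + 8 * N))
      fun ω => h1 fun t => X t ω).trans_eq ?_
    rw [integral_const, probReal_univ, one_smul]
  have hαβ0 : 0 < α * β := mul_pos hα hβ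
  have hgeo := le_geometric_of_succ_le (by linarith) (by linarith) (by positivity) hrec T hT
  rw [sub_sub_cancel] at hgeo
  have hq : 0 ≤ (1 - α * β) ^ (T - τ) := pow_nonneg (by linarith) _
  have hNτ : N ≤ N * τ := le_mul_of_one_le_right hN0 hτ1
  set W : ℝ := α ^ 2 * δ ^ 2 * G ^ 2 * τ with hW
  have hW0 : 0 ≤ W := by positivity
  have hNW : N * τ = A ^ 2 * W := by
    rw [hN, hW]
    ring
  have hGW : α ^ 2 * G ^ 2 ≤ W := by
    have h1 : 1 ≤ δ ^ 2 * τ := one_le_mul_of_one_le_of_one_le (one_le_pow₀ hδ) hτ1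
    have h2 := mul_le_mul_of_nonneg_left h1 (by positivity : 0 ≤ α ^ 2 * G ^ 2)
    rw [hW]
    linarith
  have hWdiv : α * τ * δ ^ 2 * G ^ 2 / β = W / (α * β) := by
    rw [hW]
    field_simp
  -- Since `α β < 1`, the `8 * N` left by returning to the true iterate is absorbed into the
  -- stationary term.
  have hWle : W ≤ W / (α * β) := (le_div_iff₀ hαβ0).2 (mul_le_of_le_one_right hW0 hαβ.le)
  have hc : (8 * α ^ 2 * G ^ 2 + (144 * τ + 37) * N) / (α * β) ≤
      (8 + 181 * A ^ 2) * (W / (α * β)) := by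
    rw [← mul_div_assoc]
    refine div_le_div_of_nonneg_right ?_ hαβ0.le
    linear_combination 8 * hGW + 37 * hNτ + 181 * hNW
  have hI : (1 - α * β) ^ (T - τ) * a τ ≤
      (1 - α * β) ^ (T - τ) * (8 * G ^ 2 + 8 * N) := mul_le_mul_of_nonneg_left hinit hq
  have hI2 : 16 * G ^ 2 + 16 * N ≤ 400 * (A ^ 2 + 1) * (α ^ 2 * δ ^ 2 * G ^ 2 + G ^ 2) := by
    have h1 : 0 ≤ A ^ 2 * (α ^ 2 * δ ^ 2 * G ^ 2) := by positivity
    have h2 : 0 ≤ A ^ 2 * G ^ 2 := by positivity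
    have h3 : 0 ≤ α ^ 2 * δ ^ 2 * G ^ 2 := by positivity
    have h4 : 0 ≤ G ^ 2 := by positivity
    rw [hN]
    linear_combination 384 * h1 + 400 * h2 + 400 * h3 + 384 * h4
  have hI3 := mul_le_mul_of_nonneg_right hI2 hq
  have hA2 : A ^ 2 * W ≤ A ^ 2 * (W / (α * β)) := mul_le_mul_of_nonneg_left hWle (sq_nonneg A)
  have hV0 : 0 ≤ W / (α * β) := hW0.trans hWle
  have hAV0 : 0 ≤ A ^ 2 * (W / (α * β)) := mul_nonneg (sq_nonneg A) hV0
  rw [hWdiv]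
  linear_combination hfin + 2 * hgeo + 2 * hI + hI3 + 2 * hc + 8 * hNτ + 8 * hNW + 8 * hA2 +
    384 * hV0 + 30 * hAV0
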